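/- An infinite word $w=w_0w_1w_2\cdots$ over the alphabet $\{1,2\}$ is \emph{Sturmian} if, for every $n\in\mathbb{N}$, it has exactly $n+1$ distinct factors (blocks of consecutive letters) of length $n$. A Sturmian word is \emph{of type} $1$ if $11$ is one of its factors, and \emph{of type} $2$ otherwise. For $i\in\{1,2\}$, with $j$ the other letter, let $R_i(w)$ be the infinite word obtained from $w$ by erasing every letter $i$ that immediately precedes an occurrence of $j$ (an initial $j$ is simply kept). The renormalization of $w$ is $R(w)=R_i(w)$, where $i$ is the type of $w$. Let $i_n\in\{1,2\}$ be the type of the iterate $R^n(w)$, so that $R_{i_0},R_{i_1},R_{i_2},\dots$ are the operators successively applied when $R$ is iterated on $w$. The \emph{run-length sequence} of $w$ under $R$ is the sequence $(b_n)_{n\in\mathbb{N}}$ of natural numbers, with $b_n\ge 1$ for all $n\ge 1$ (and $b_0\geq 0$), such that $$i_0i_1i_2i_3\cdots = 1^{b_0}2^{b_1}1^{b_2}2^{b_3}\cdots .$$ \textbf{Theorem.} Let $w$ be a Sturmian word over $\{1,2\}$. Then its run-length sequence $(b_n)_{n\in\mathbb{N}}$ under iteration of $R$ exists and is unique, and: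 (i) $w$ admits letter frequencies: for $a\in\{1,2\}$, the limit $f_a=\lim_{n\to\infty}\frac1n\,\#\{0\le k<n : w_k=a\}$ exists; (ii) $[b_0;b_1,b_2,b_3,\dots]$ is the continued fraction expansion of $f_1/f_2$, i.e. the (infinite) sequence of partial quotients produced by the continued fraction algorithm (output $\lfloor x\rfloor$, then, if $\{x\}\neq0$, continue with $1/\{x\}$) applied to $x=f_1/f_2$; (iii) $f_1/f_2$ is irrational. -/

import Mathlib

namespace Sturmian

/-- The two-letter alphabet `{1, 2}`. -/
inductive Letter where
  | one : Letter
  | two : Letter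
  deriving DecidableEq

/-- The factors of length `n` of the infinite word `w`: the blocks of `n` consecutive letters
that occur in `w`. -/
def factors {A : Type*} (w : ℕ → A) (n : ℕ) : Set (Fin n → A) :=
  {u | ∃ k : ℕ, ∀ t : Fin n, u t = w (k + t)}

/-- The complexity function of `w`: the number of factors of each length. -/
noncomputable def complexity {A : Type*} (w : ℕ → A) (n : ℕ) : ℕ :=
  (factors w n).ncard

/-- An infinite word over `{1, 2}` is Sturmian if it has exactly `n + 1` factors of length `n`,
for every `n`. -/
def IsSturmian (w : ℕ → Letter) : Prop :=
  ∀ n : ℕ, complexity w n = n + 1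

open Classical in
/-- The type of a word: `1` if the word contains the factor `11`, and `2` otherwise. -/
noncomputable def wordType (w : ℕ → Letter) : Letter :=
  if ![Letter.one, Letter.one] ∈ factors w 2 then Letter.one else Letter.two

/-- Position `n` survives the erasure operator `R_i` unless it carries a letter `i` that
immediately precedes an occurrence of the other letter. -/
def Kept (i : Letter) (w : ℕ → Letter) (n : ℕ) : Prop :=
  ¬ (w n = i ∧ w (n + 1) ≠ i)

/-- Infinitely many positions are kept, so that erasing the others leaves an infinite word. -/
theorem infinite_kept (i : Letter) (w : ℕ → Letter) : {n | Kept i w n}.Infinite := by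
  rw [Set.infinite_iff_exists_gt]
  intro a
  by_cases h : Kept i w (a + 1)
  · exact ⟨a + 1, h, Nat.lt_succ_self a⟩
  · have h' : w (a + 1) = i ∧ w (a + 1 + 1) ≠ i := not_not.mp h
    exact ⟨a + 1 + 1, fun hh => h'.2 hh.1, by omega⟩

/-- The operator `R_i`: erase from `w` the letter `i` that immediately precedes each occurrence of
the other letter. The `k`-th letter of the new word is the letter of `w` at the `k`-th kept
position. -/
noncomputable def eraseBefore (i : Letter) (w : ℕ → Letter) : ℕ → Letter :=
  fun k => w (Nat.nth (Kept i w) k)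

/-- The renormalization `R`: apply `R_i`, where `i` is the type of `w`. -/
noncomputable def renorm (w : ℕ → Letter) : ℕ → Letter :=
  eraseBefore (wordType w) w

/-- The sequence `i₀ i₁ i₂ …` of indices of the operators `R_{i₀}, R_{i₁}, …` that are
successively applied when `R` is iterated on `w`. -/
noncomputable def operatorSeq (w : ℕ → Letter) : ℕ → Letter :=
  fun n => wordType (renorm^[n] w)

/-- `b` is the run-length sequence of `s`, that is, `s = 1^{b 0} 2^{b 1} 1^{b 2} 2^{b 3} …`, where
only `b 0` may vanish: the `k`-th run occupies the `b k` positions that follow the previous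
runs. -/
def IsRunLength (s : ℕ → Letter) (b : ℕ → ℕ) : Prop :=
  (∀ k : ℕ, 1 ≤ k → 0 < b k) ∧
    ∀ k m : ℕ, m < b k →
      s ((∑ l ∈ Finset.range k, b l) + m) = if Even k then Letter.one else Letter.two

/-- The letter `a` has frequency `f` in `w`: the proportion of `a` among the first `n` letters of
`w` tends to `f`. -/
def HasFrequency (w : ℕ → Letter) (a : Letter) (f : ℝ) : Prop :=
  Filter.Tendsto (fun n : ℕ => (Nat.count (fun k => w k = a) n : ℝ) / (n : ℝ))
    Filter.atTop (nhds f)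

/-- The continued fraction expansion of `x`, as computed by the continued fraction algorithm, is
infinite and equal to `[b 0; b 1, b 2, …]`. -/
def HasContFractExpansion (x : ℝ) (b : ℕ → ℕ) : Prop :=
  (GenContFract.of x).h = (b 0 : ℝ) ∧
    ∀ n : ℕ, (GenContFract.of x).s.get? n = some ⟨1, (b (n + 1) : ℝ)⟩

end Sturmian

namespace Sturmian

theorem Letter.eq_of_ne_of_ne {a b c : Letter} (ha : a ≠ c) (hb : b ≠ c) : a = b := by
  cases a <;> cases b <;> cases c <;> simp_all

/-- The word `w` is not eventually periodic. -/
def IsAperiodic (w : ℕ → Letter) : Prop :=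
  ∀ N p : ℕ, 0 < p → ∃ n, N ≤ n ∧ w (n + p) ≠ w n

/-- For each length, the word `w` has at most one right special factor. -/
def UniqueRightSpecial (w : ℕ → Letter) : Prop :=
  ∀ n i j k l : ℕ, (∀ t < n, w (i + t) = w (j + t)) → w (i + n) ≠ w (j + n) →
    (∀ t < n, w (k + t) = w (l + t)) → w (k + n) ≠ w (l + n) →
    ∀ t < n, w (i + t) = w (k + t)

/-! ### Consequences of the complexity condition -/

theorem IsSturmian.finite_factors {w : ℕ → Letter} (hw : IsSturmian w) (n : ℕ) :
    (factors w n).Finite := by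
  apply Set.finite_of_ncard_ne_zero
  have := hw n
  unfold complexity at this
  omega

theorem IsSturmian.isAperiodic {w : ℕ → Letter} (hw : IsSturmian w) : IsAperiodic w := by
  intro N p hp
  by_contra! h
  have key : ∀ k, ∃ k' < N + p, ∀ t, w (k + t) = w (k' + t) := by
    intro k
    induction k using Nat.strong_induction_on with
    | _ k ih =>
      by_cases hk : k < N + p
      · exact ⟨k, hk, fun _ => rfl⟩
      · obtain ⟨k', hk', h'⟩ := ih (k - p) (by omega)
        refine ⟨k', hk', fun t => ?_⟩
        rw [← h' t, ← h (k - p + t) (by omega)]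
        congr 1
        omega
  have hsub : factors w (N + p) ⊆
      (fun k => fun t : Fin (N + p) => w (k + t)) '' (Finset.range (N + p) : Set ℕ) := by
    rintro u ⟨k, hk⟩
    obtain ⟨k', hk', h'⟩ := key k
    refine ⟨k', by simpa using hk', ?_⟩
    funext t
    rw [hk t, h' t]
  have h1 := Set.ncard_le_ncard hsub ((Finset.finite_toSet _).image _)
  have h2 := Set.ncard_image_le (f := fun k => fun t : Fin (N + p) => w (k + t))
    (Finset.finite_toSet (Finset.range (N + p)))
  rw [Set.ncard_coe_finset, Finset.card_range] at h2
  have h3 := hw (N + p)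
  unfold complexity at h3
  omega

theorem IsSturmian.uniqueRightSpecial {w : ℕ → Letter} (hw : IsSturmian w) :
    UniqueRightSpecial w := by
  intro n i j k l hij hij' hkl hkl'
  let E : Letter → Set (Fin n → Letter) := fun a =>
    {u | ∃ k, (∀ t : Fin n, u t = w (k + t)) ∧ w (k + n) = a}
  have hunion : E Letter.one ∪ E Letter.two = factors w n := by
    ext u
    constructor
    · rintro (⟨k, hk, -⟩ | ⟨k, hk, -⟩) <;> exact ⟨k, hk⟩
    · rintro ⟨k, hk⟩
      rcases h : w (k + n) with _ | _
      · exact Or.inl ⟨k, hk, h⟩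
      · exact Or.inr ⟨k, hk, h⟩
  have hfin : ∀ a, (E a).Finite := fun a => by
    refine (hw.finite_factors n).subset ?_
    rintro u ⟨k, hk, -⟩
    exact ⟨k, hk⟩
  let ext' : Letter → (Fin n → Letter) → (Fin (n + 1) → Letter) := fun a u => Fin.snoc u a
  have hinj : ∀ a, Function.Injective (ext' a) := by
    intro a u v huv
    have := congrArg Fin.init huv
    simpa [ext', Fin.init_snoc] using this
  have hsucc : ext' Letter.one '' E Letter.one ∪ ext' Letter.two '' E Letter.two
      = factors w (n + 1) := by
    have hE : ∀ a u, u ∈ E a → ext' a u ∈ factors w (n + 1) := by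
      rintro a u ⟨k, hk, ha⟩
      refine ⟨k, fun t => ?_⟩
      refine Fin.lastCases ?_ (fun t => ?_) t
      · simp [ext', ha]
      · simp [ext', hk]
    ext u
    constructor
    · rintro (⟨v, hv, rfl⟩ | ⟨v, hv, rfl⟩)
      · exact hE _ _ hv
      · exact hE _ _ hv
    · rintro ⟨k, hk⟩
      have hu : ∀ a, w (k + n) = a → u ∈ ext' a '' E a := by
        intro a ha
        refine ⟨Fin.init u, ⟨k, fun t => by simp [Fin.init, hk], ha⟩, ?_⟩
        have : u (Fin.last n) = a := by rw [hk, ← ha]; rfl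
        simp only [ext']
        rw [← this, Fin.snoc_init_self]
      rcases h : w (k + n) with _ | _
      · exact Or.inl (hu _ h)
      · exact Or.inr (hu _ h)
  have hdisj : Disjoint (ext' Letter.one '' E Letter.one) (ext' Letter.two '' E Letter.two) := by
    rw [Set.disjoint_left]
    rintro _ ⟨u, -, rfl⟩ ⟨v, -, hv⟩
    have := congrFun hv (Fin.last n)
    simp [ext'] at this
  have c1 := Set.ncard_union_add_ncard_inter (E Letter.one) (E Letter.two) (hfin _) (hfin _)
  have c2 := Set.ncard_union_eq hdisj ((hfin _).image _) ((hfin _).image _)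
  rw [hsucc, Set.ncard_image_of_injective _ (hinj _),
    Set.ncard_image_of_injective _ (hinj _)] at c2
  rw [hunion] at c1
  have c3 := hw n
  have c4 := hw (n + 1)
  unfold complexity at c3 c4
  have hcard : (E Letter.one ∩ E Letter.two).ncard ≤ 1 := by omega
  rw [Set.ncard_le_one ((hfin _).inter_of_left _)] at hcard
  have hmem : ∀ i j, (∀ t < n, w (i + t) = w (j + t)) → w (i + n) ≠ w (j + n) →
      (fun t : Fin n => w (i + t)) ∈ E Letter.one ∩ E Letter.two := by
    intro i j h h'
    have hi : (fun t : Fin n => w (i + t)) ∈ E (w (i + n)) := ⟨i, fun _ => rfl, rfl⟩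
    have hj : (fun t : Fin n => w (i + t)) ∈ E (w (j + n)) := ⟨j, fun t => h t t.2, rfl⟩
    rcases h1 : w (i + n) with _ | _ <;> rcases h2 : w (j + n) with _ | _ <;>
      rw [h1] at hi <;> rw [h2] at hj
    · exact absurd (h1.trans h2.symm) h'
    · exact ⟨hi, hj⟩
    · exact ⟨hj, hi⟩
    · exact absurd (h1.trans h2.symm) h'
  have heq := hcard _ (hmem i j hij hij') _ (hmem k l hkl hkl')
  exact fun t ht => congrFun heq ⟨t, ht⟩

/-! ### The type of a word -/

theorem IsAperiodic.exists_change {w : ℕ → Letter} (hw : IsAperiodic w) (c : Letter) (N : ℕ) :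
    ∃ m, N ≤ m ∧ w m = c ∧ w (m + 1) ≠ c := by
  by_contra! h
  obtain ⟨n, hn, hn'⟩ := hw N 1 one_pos
  have h1 : w (n + 1) = c := by
    by_contra hne
    exact hn' (Letter.eq_of_ne_of_ne hne fun hc => hne (h n hn hc))
  have h2 : ∀ t, w (n + 1 + t) = c := by
    intro t
    induction t with
    | zero => exact h1
    | succ t ih => exact h (n + 1 + t) (by omega) ih
  obtain ⟨m, hm, hm'⟩ := hw (n + 1) 1 one_pos
  obtain ⟨t, rfl⟩ := Nat.exists_eq_add_of_le hm
  exact hm' ((h2 (t + 1)).trans (h2 t).symm)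

theorem eq_wordType_or {w : ℕ → Letter} (ha : IsAperiodic w) (hu : UniqueRightSpecial w)
    (n : ℕ) : w n = wordType w ∨ w (n + 1) = wordType w := by
  unfold wordType
  split_ifs with h
  · by_contra! hn
    obtain ⟨k, hk⟩ := h
    have h0 : Letter.one = w k := by simpa using hk 0
    have h1 : Letter.one = w (k + 1) := by simpa using hk 1
    obtain ⟨m, -, hm, hm'⟩ := ha.exists_change Letter.one 0
    obtain ⟨m₂, -, hm₂, hm₂'⟩ := ha.exists_change Letter.two 0
    have := hu 1 k m n m₂ (by simp [hm, ← h0]) (by rw [← h1]; exact hm'.symm)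
      (by
        simp only [Nat.lt_one_iff, forall_eq, add_zero, hm₂]
        exact Letter.eq_of_ne_of_ne hn.1 (by simp))
      (by
        rw [Letter.eq_of_ne_of_ne hn.2 (show Letter.two ≠ Letter.one by simp)]
        exact hm₂'.symm) 0 one_pos
    exact hn.1 (this.symm.trans h0.symm)
  · by_contra! hn
    refine h ⟨n, fun t => ?_⟩
    have e0 := Letter.eq_of_ne_of_ne (show Letter.one ≠ Letter.two by simp) hn.1
    have e1 := Letter.eq_of_ne_of_ne (show Letter.one ≠ Letter.two by simp) hn.2
    fin_cases t
    · simpa using e0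
    · simpa using e1

/-! ### The erasure operator on words where the other letter is isolated -/

section Erase

variable {i : Letter} {w : ℕ → Letter}

theorem kept_nth (i : Letter) (w : ℕ → Letter) (k : ℕ) : Kept i w (Nat.nth (Kept i w) k) :=
  Nat.nth_mem_of_infinite (infinite_kept i w) k

theorem kept_of_ne {n : ℕ} (h : w n ≠ i) : Kept i w n := fun hh => h hh.1

open Classical in
theorem eraseBefore_count {n : ℕ} (h : Kept i w n) :
    eraseBefore i w (Nat.count (Kept i w) n) = w n := by
  unfold eraseBefore
  rw [Nat.nth_count h]

theorem apply_nth_add_one (h : ∀ n, w n = i ∨ w (n + 1) = i) (k : ℕ) :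
    w (Nat.nth (Kept i w) k + 1) = i := by
  by_contra hne
  exact kept_nth i w k ⟨(h _).resolve_right hne, hne⟩

open Classical in
theorem nth_kept_succ (h : ∀ n, w n = i ∨ w (n + 1) = i) (k : ℕ) :
    (Nat.nth (Kept i w) (k + 1) = Nat.nth (Kept i w) k + 1 ∧ eraseBefore i w (k + 1) = i ∧
        w (Nat.nth (Kept i w) k + 2) = i) ∨
      (Nat.nth (Kept i w) (k + 1) = Nat.nth (Kept i w) k + 2 ∧ eraseBefore i w (k + 1) ≠ i ∧
        w (Nat.nth (Kept i w) k + 2) ≠ i) := by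
  have hc : Nat.count (Kept i w) (Nat.nth (Kept i w) k) = k :=
    Nat.count_nth_of_infinite (infinite_kept i w) k
  have hk := kept_nth i w k
  have h1 := apply_nth_add_one h k
  unfold eraseBefore
  generalize Nat.nth (Kept i w) k = q at *
  have hc1 : Nat.count (Kept i w) (q + 1) = k + 1 := by rw [Nat.count_succ, hc, if_pos hk]
  by_cases hq : Kept i w (q + 1)
  · have e : Nat.nth (Kept i w) (k + 1) = q + 1 := by rw [← hc1, Nat.nth_count hq]
    refine Or.inl ⟨e, by rw [e, h1], ?_⟩
    by_contra hne
    exact hq ⟨h1, hne⟩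
  · have h2 : w (q + 2) ≠ i := (not_not.mp hq).2
    have hc2 : Nat.count (Kept i w) (q + 2) = k + 1 := by
      rw [Nat.count_succ, hc1, if_neg hq]
    have e : Nat.nth (Kept i w) (k + 1) = q + 2 := by
      rw [← hc2, Nat.nth_count (kept_of_ne h2)]
    exact Or.inr ⟨e, by rwa [e], h2⟩

theorem nth_kept_gap (h : ∀ n, w n = i ∨ w (n + 1) = i) (n x y : ℕ)
    (hxy : ∀ t < n, eraseBefore i w (x + 1 + t) = eraseBefore i w (y + 1 + t)) :
    ∃ d, n ≤ d ∧ Nat.nth (Kept i w) (x + n) = Nat.nth (Kept i w) x + d ∧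
      Nat.nth (Kept i w) (y + n) = Nat.nth (Kept i w) y + d ∧
      ∀ r < d, w (Nat.nth (Kept i w) x + 1 + r) = w (Nat.nth (Kept i w) y + 1 + r) := by
  induction n with
  | zero => exact ⟨0, le_rfl, rfl, rfl, by simp⟩
  | succ n ih =>
    obtain ⟨d, hd, hx, hy, hr⟩ := ih fun t ht => hxy t (by omega)
    have hn : eraseBefore i w (x + n + 1) = eraseBefore i w (y + n + 1) := by
      have := hxy n (by omega)
      rwa [show x + 1 + n = x + n + 1 by omega, show y + 1 + n = y + n + 1 by omega] at this
    have e1x := apply_nth_add_one h (x + n)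
    have e1y := apply_nth_add_one h (y + n)
    rcases nth_kept_succ h (x + n) with ⟨ax, bx, cx⟩ | ⟨ax, bx, cx⟩ <;>
      rcases nth_kept_succ h (y + n) with ⟨ay, bY, cy⟩ | ⟨ay, bY, cy⟩
    · refine ⟨d + 1, by omega, by rw [← add_assoc, ax]; omega, by rw [← add_assoc, ay]; omega,
        fun r hr' => ?_⟩
      rcases Nat.lt_succ_iff_lt_or_eq.mp hr' with hlt | rfl
      · exact hr r hlt
      · rw [hx] at e1x
        rw [hy] at e1y
        rw [add_right_comm, e1x, add_right_comm, e1y]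
    · exact absurd (hn.symm.trans bx) bY
    · exact absurd (hn.trans bY) bx
    · refine ⟨d + 2, by omega, by rw [← add_assoc, ax]; omega, by rw [← add_assoc, ay]; omega,
        fun r hr' => ?_⟩
      rcases (show r < d ∨ r = d ∨ r = d + 1 by omega) with hlt | rfl | rfl
      · exact hr r hlt
      · rw [hx] at e1x
        rw [hy] at e1y
        rw [add_right_comm, e1x, add_right_comm, e1y]
      · rw [hx] at cx
        rw [hy] at cy
        have := Letter.eq_of_ne_of_ne cx cy
        convert this using 2 <;> omega

theorem IsAperiodic.eraseBefore (ha : IsAperiodic w) (h : ∀ n, w n = i ∨ w (n + 1) = i) :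
    IsAperiodic (eraseBefore i w) := by
  intro N p hp
  by_contra! hper
  have hmono := Nat.nth_strictMono (infinite_kept i w)
  have hlt : Nat.nth (Kept i w) N < Nat.nth (Kept i w) (N + p) := hmono (by omega)
  obtain ⟨n, hn, hne⟩ := ha (Nat.nth (Kept i w) N + 1)
    (Nat.nth (Kept i w) (N + p) - Nat.nth (Kept i w) N) (by omega)
  obtain ⟨r, rfl⟩ := Nat.exists_eq_add_of_le hn
  obtain ⟨d, hd, -, -, hr⟩ := nth_kept_gap h (r + 1) N (N + p) fun t _ => by
    rw [← hper (N + 1 + t) (by omega)]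
    congr 1
    omega
  apply hne
  rw [hr r (by omega)]
  congr 1
  omega

theorem UniqueRightSpecial.eraseBefore (hu : UniqueRightSpecial w)
    (h : ∀ n, w n = i ∨ w (n + 1) = i) : UniqueRightSpecial (eraseBefore i w) := by
  have copy : ∀ n x y, (∀ t < n + 1, Sturmian.eraseBefore i w (x + t) =
      Sturmian.eraseBefore i w (y + t)) →
      Sturmian.eraseBefore i w (x + (n + 1)) ≠ Sturmian.eraseBefore i w (y + (n + 1)) →
      ∃ d, Nat.nth (Kept i w) (x + n) = Nat.nth (Kept i w) x + d ∧
      Nat.nth (Kept i w) (y + n) = Nat.nth (Kept i w) y + d ∧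
      (∀ r < d + 2, w (Nat.nth (Kept i w) x + r) = w (Nat.nth (Kept i w) y + r)) ∧
      w (Nat.nth (Kept i w) x + (d + 2)) ≠ w (Nat.nth (Kept i w) y + (d + 2)) := by
    intro n x y hxy hne
    obtain ⟨d, -, hx, hy, hr⟩ := nth_kept_gap h n x y fun t ht => by
      rw [add_assoc, add_assoc, add_comm 1 t]
      exact hxy (t + 1) (by omega)
    refine ⟨d, hx, hy, fun r hr' => ?_, ?_⟩
    · rcases (show r = 0 ∨ r = d + 1 ∨ (1 ≤ r ∧ r - 1 < d) by omega) with rfl | rfl | ⟨h1, h2⟩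
      · exact hxy 0 (by omega)
      · have e1x := apply_nth_add_one h (x + n)
        have e1y := apply_nth_add_one h (y + n)
        rw [hx] at e1x
        rw [hy] at e1y
        exact e1x.trans e1y.symm
      · have := hr (r - 1) h2
        convert this using 2 <;> omega
    · rw [← add_assoc, ← add_assoc, ← hx, ← hy]
      rcases nth_kept_succ h (x + n) with ⟨ax, bx, cx⟩ | ⟨ax, bx, cx⟩ <;>
        rcases nth_kept_succ h (y + n) with ⟨ay, bY, cy⟩ | ⟨ay, bY, cy⟩
      · exact absurd (bx.trans bY.symm) hne
      · rw [cx]; exact cy.symm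
      · rw [cy]; exact cx
      · exact absurd (Letter.eq_of_ne_of_ne bx bY) hne
  intro n
  induction n with
  | zero => intro _ _ _ _ _ _ _ _ t ht; omega
  | succ n ih =>
    intro a b c e hab hab' hce hce'
    have shift : ∀ x y, (∀ t < n + 1, Sturmian.eraseBefore i w (x + t) =
        Sturmian.eraseBefore i w (y + t)) → ∀ t < n, Sturmian.eraseBefore i w (x + 1 + t) =
        Sturmian.eraseBefore i w (y + 1 + t) := by
      intro x y hxy t ht
      have := hxy (t + 1) (by omega)
      convert this using 2 <;> omega
    have tail := ih (a + 1) (b + 1) (c + 1) (e + 1) (shift _ _ hab)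
      (by rwa [add_assoc, add_assoc, add_comm 1 n]) (shift _ _ hce)
      (by rwa [add_assoc, add_assoc, add_comm 1 n])
    have head : Sturmian.eraseBefore i w a = Sturmian.eraseBefore i w c := by
      obtain ⟨d, hd, -, h1, h2⟩ := copy n a b hab hab'
      obtain ⟨d', hd', -, h3, h4⟩ := copy n c e hce hce'
      obtain ⟨d'', -, h5, h6, -⟩ := nth_kept_gap h n a c tail
      obtain rfl : d'' = d := by omega
      obtain rfl : d'' = d' := by omega
      exact hu _ _ _ _ _ h1 h2 h3 h4 0 (by omega)
    intro t ht
    rcases t with _ | t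
    · exact head
    · have := tail t (by omega)
      convert this using 2 <;> omega

/-! ### Counting letters -/

open Classical in
theorem count_eraseBefore (a : Letter) (n : ℕ) :
    Nat.count (fun k => eraseBefore i w k = a) (Nat.count (Kept i w) n) =
      Nat.count (fun k => Kept i w k ∧ w k = a) n := by
  induction n with
  | zero => simp
  | succ n ih =>
    by_cases hk : Kept i w n
    · rw [Nat.count_succ, if_pos hk, Nat.count_succ, Nat.count_succ, ih, eraseBefore_count hk]
      simp only [hk, true_and]
    · rw [Nat.count_succ, if_neg hk, add_zero, Nat.count_succ, ih]
      simp only [hk, false_and, if_false, add_zero]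

open Classical in
theorem count_eraseBefore_of_ne {a : Letter} (ha : a ≠ i) (n : ℕ) :
    Nat.count (fun k => eraseBefore i w k = a) (Nat.count (Kept i w) n) =
      Nat.count (fun k => w k = a) n := by
  rw [count_eraseBefore]
  have : (fun k => Kept i w k ∧ w k = a) = fun k => w k = a := by
    funext k
    exact propext ⟨fun h => h.2, fun h => ⟨kept_of_ne (h ▸ ha), h⟩⟩
  simp only [this]

open Classical in
theorem count_eraseBefore_self (h : ∀ n, w n = i ∨ w (n + 1) = i) {j : Letter} (hj : j ≠ i)
    (n : ℕ) :
    Nat.count (fun k => eraseBefore i w k = i) (Nat.count (Kept i w) n) +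
        Nat.count (fun k => w k = j) (n + 1) =
      Nat.count (fun k => w k = i) n + if w 0 = j then 1 else 0 := by
  rw [count_eraseBefore]
  induction n with
  | zero => simp [Nat.count_succ]
  | succ n ih =>
    rw [Nat.count_succ (fun k => w k = j), Nat.count_succ, Nat.count_succ (fun k => w k = i)]
    by_cases h0 : w n = i
    · by_cases h1 : w (n + 1) = i
      · have hK : Kept i w n := fun hh => hh.2 h1
        have : w (n + 1) ≠ j := by rw [h1]; exact hj.symm
        simp only [h0, hK, this, and_self, if_true, if_false]
        omega
      · have hK : ¬ Kept i w n := fun hh => hh ⟨h0, h1⟩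
        have : w (n + 1) = j := Letter.eq_of_ne_of_ne h1 hj
        simp only [h0, hK, this, false_and, if_true, if_false]
        omega
    · have h1 : w (n + 1) ≠ j := by rw [(h n).resolve_left h0]; exact hj.symm
      simp only [h0, h1, and_false, if_false]
      omega

end Erase

/-! ### Iterating the renormalization -/

theorem IsAperiodic.renorm {w : ℕ → Letter} (ha : IsAperiodic w) (hu : UniqueRightSpecial w) :
    IsAperiodic (renorm w) :=
  ha.eraseBefore (eq_wordType_or ha hu)

theorem UniqueRightSpecial.renorm {w : ℕ → Letter} (hu : UniqueRightSpecial w)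
    (ha : IsAperiodic w) : UniqueRightSpecial (renorm w) :=
  hu.eraseBefore (eq_wordType_or ha hu)

theorem iterate_renorm {w : ℕ → Letter} (ha : IsAperiodic w) (hu : UniqueRightSpecial w)
    (n : ℕ) : IsAperiodic (renorm^[n] w) ∧ UniqueRightSpecial (renorm^[n] w) := by
  induction n with
  | zero => exact ⟨ha, hu⟩
  | succ n ih =>
    rw [Function.iterate_succ_apply']
    exact ⟨ih.1.renorm ih.2, ih.2.renorm ih.1⟩

open Classical in
theorem not_forall_operatorSeq_eq_of_gap {i : Letter} (d : ℕ) : ∀ (w : ℕ → Letter) (p : ℕ),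
    IsAperiodic w → UniqueRightSpecial w → w p ≠ i → w (p + d + 1) ≠ i →
    ¬ ∀ n, operatorSeq w n = i := by
  induction d using Nat.strong_induction_on with
  | _ d ih =>
    intro w p ha hu hp hq hs
    have hi : wordType w = i := hs 0
    have h : ∀ n, w n = i ∨ w (n + 1) = i := hi ▸ eq_wordType_or ha hu
    have hw' : renorm w = eraseBefore i w := by rw [renorm, hi]
    have hs' : ∀ n, operatorSeq (renorm w) n = i := fun n => hs (n + 1)
    have hd : ¬ Kept i w (p + d) := fun hk => hk ⟨(h _).resolve_right hq, hq⟩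
    have hlt : Nat.count (Kept i w) p < Nat.count (Kept i w) (p + d + 1) :=
      Nat.count_strict_mono (kept_of_ne hp) (by omega)
    have hle : Nat.count (Kept i w) (p + d + 1) ≤ Nat.count (Kept i w) p + d := by
      rw [Nat.count_succ, if_neg hd, Nat.count_add]
      have := Nat.count_le (p := fun k => Kept i w (p + k)) (n := d)
      omega
    refine ih (Nat.count (Kept i w) (p + d + 1) - Nat.count (Kept i w) p - 1) (by omega)
      (renorm w) (Nat.count (Kept i w) p) (ha.renorm hu) (hu.renorm ha) ?_ ?_ hs'
    · rwa [hw', eraseBefore_count (kept_of_ne hp)]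
    · rw [hw', show ∀ a b : ℕ, a < b → a + (b - a - 1) + 1 = b by omega,
        eraseBefore_count (kept_of_ne hq)]
      · exact hq
      · exact hlt

theorem exists_operatorSeq_ne {w : ℕ → Letter} (ha : IsAperiodic w) (hu : UniqueRightSpecial w)
    (c : Letter) (N : ℕ) : ∃ n, operatorSeq w (N + n) ≠ c := by
  by_contra! h
  obtain ⟨ha', hu'⟩ := iterate_renorm ha hu N
  obtain ⟨m, -, -, hm⟩ := ha'.exists_change c 0
  obtain ⟨m', hmm', -, hm'⟩ := ha'.exists_change c (m + 1)
  refine not_forall_operatorSeq_eq_of_gap (m' - m - 1) _ (m + 1) ha' hu' hm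
    (by rwa [show m + 1 + (m' - m - 1) + 1 = m' + 1 by omega]) fun n => ?_
  rw [← h n]
  unfold operatorSeq
  rw [add_comm N n, Function.iterate_add_apply]

end Sturmian

namespace Sturmian

/-- The letter of the `k`-th run of an operator sequence. -/
def runLetter (k : ℕ) : Letter := if Even k then Letter.one else Letter.two

theorem runLetter_succ_ne (k : ℕ) : runLetter (k + 1) ≠ runLetter k := by
  unfold runLetter
  by_cases h : Even k <;> simp [h, Nat.even_add_one]

/-! ### Run-length sequences -/

theorem exists_isRunLength {s : ℕ → Letter} (hs : ∀ c N, ∃ n, s (N + n) ≠ c) :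
    ∃ b, IsRunLength s b := by
  classical
  let len : Letter → ℕ → ℕ := fun c N => Nat.find (hs c N)
  let S : ℕ → ℕ := fun k => Nat.rec 0 (fun k r => r + len (runLetter k) r) k
  have hS : ∀ k, S (k + 1) = S k + len (runLetter k) (S k) := fun _ => rfl
  have hsum : ∀ k, ∑ l ∈ Finset.range k, len (runLetter l) (S l) = S k := by
    intro k
    induction k with
    | zero => rfl
    | succ k ih => rw [Finset.sum_range_succ, ih, hS]
  refine ⟨fun k => len (runLetter k) (S k), fun k hk => ?_, fun k m hm => ?_⟩
  · obtain ⟨k, rfl⟩ := Nat.exists_eq_add_of_le' hk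
    rw [Nat.find_pos, not_not, add_zero, hS]
    exact Letter.eq_of_ne_of_ne (Nat.find_spec (hs (runLetter k) (S k))) (runLetter_succ_ne k)
  · rw [hsum]
    exact not_not.mp (Nat.find_min (hs (runLetter k) (S k)) hm)

theorem IsRunLength.le_of_forall_eq {s : ℕ → Letter} {b b' : ℕ → ℕ} (hb : IsRunLength s b)
    (hb' : IsRunLength s b') {k : ℕ} (h : ∀ l < k, b l = b' l) : b' k ≤ b k := by
  by_contra! hlt
  have hsum : ∑ l ∈ Finset.range k, b l = ∑ l ∈ Finset.range k, b' l :=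
    Finset.sum_congr rfl fun l hl => h l (Finset.mem_range.mp hl)
  have h1 := hb'.2 k (b k) hlt
  have h2 := hb.2 (k + 1) 0 (hb.1 (k + 1) (by omega))
  rw [add_zero, Finset.sum_range_succ, hsum] at h2
  exact runLetter_succ_ne k (h2.symm.trans h1)

theorem IsRunLength.unique {s : ℕ → Letter} {b b' : ℕ → ℕ} (hb : IsRunLength s b)
    (hb' : IsRunLength s b') : b = b' := by
  funext k
  induction k using Nat.strong_induction_on with
  | _ k ih =>
    exact le_antisymm (hb'.le_of_forall_eq hb fun l hl => (ih l hl).symm)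
      (hb.le_of_forall_eq hb' ih)

/-! ### Continued fraction expansions -/

theorem hasContFractExpansion_of_recurrence {y : ℕ → ℝ} {b : ℕ → ℕ}
    (hpos : ∀ k, 0 < y (k + 1)) (hb : ∀ k, 0 < b (k + 1))
    (hy : ∀ k, y k = b k + (y (k + 1))⁻¹) : HasContFractExpansion (y 0) b := by
  have hone : ∀ k, 1 < y (k + 1) := by
    intro k
    have h1 : (1 : ℝ) ≤ b (k + 1) := by exact_mod_cast hb k
    have h2 := inv_pos.mpr (hpos (k + 1))
    rw [hy (k + 1)]
    linarith
  have hfloor : ∀ k, ⌊y k⌋ = (b k : ℤ) := by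
    intro k
    have h1 := inv_pos.mpr (hpos k)
    have h2 := inv_lt_one_of_one_lt₀ (hone k)
    rw [Int.floor_eq_iff, hy k, Int.cast_natCast]
    constructor <;> linarith
  have hof : ∀ k, GenContFract.IntFractPair.of (y k) = ⟨(b k : ℤ), (y (k + 1))⁻¹⟩ := by
    intro k
    have : Int.fract (y k) = (y (k + 1))⁻¹ := by
      rw [Int.fract, hfloor, hy k, Int.cast_natCast]
      ring
    rw [GenContFract.IntFractPair.of, hfloor, this]
  have hstream : ∀ n, GenContFract.IntFractPair.stream (y 0) n =
      some ⟨(b n : ℤ), (y (n + 1))⁻¹⟩ := by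
    intro n
    induction n with
    | zero => rw [GenContFract.IntFractPair.stream_zero, hof]
    | succ n ih =>
      rw [GenContFract.IntFractPair.stream_succ_of_some ih (inv_pos.mpr (hpos n)).ne', inv_inv,
        hof]
  refine ⟨by rw [GenContFract.of_h_eq_floor, hfloor, Int.cast_natCast], fun n => ?_⟩
  rw [GenContFract.get?_of_eq_some_of_succ_get?_intFractPair_stream (hstream (n + 1)),
    Int.cast_natCast]

theorem HasContFractExpansion.unique {x y : ℝ} {b : ℕ → ℕ} (hx : HasContFractExpansion x b)
    (hy : HasContFractExpansion y b) : x = y := by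
  have h : GenContFract.of x = GenContFract.of y :=
    GenContFract.ext (hx.1.trans hy.1.symm)
      (Stream'.Seq.ext fun n => (hx.2 n).trans (hy.2 n).symm)
  have h1 := GenContFract.of_convergence x
  rw [h] at h1
  exact tendsto_nhds_unique h1 (GenContFract.of_convergence y)

theorem HasContFractExpansion.irrational {x : ℝ} {b : ℕ → ℕ} (hx : HasContFractExpansion x b) :
    Irrational x := by
  rintro ⟨q, rfl⟩
  obtain ⟨n, hn⟩ := (GenContFract.terminates_iff_rat (q : ℝ)).mpr ⟨q, rfl⟩
  have : (GenContFract.of (q : ℝ)).s.get? n = none := hn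
  rw [hx.2 n] at this
  cases this

/-! ### The subtractive algorithm on pairs of nonnegative reals -/

/-- The other letter. -/
def Letter.other : Letter → Letter
  | Letter.one => Letter.two
  | Letter.two => Letter.one

theorem Letter.other_ne (i : Letter) : i.other ≠ i := by cases i <;> simp [Letter.other]

/-- Subtract from the coordinate `i` of a pair its other coordinate. -/
def subtractAt (i : Letter) (a : Letter → ℝ) : Letter → ℝ :=
  fun l => if l = i then a i - a i.other else a l

theorem subtractAt_self (i : Letter) (a : Letter → ℝ) : subtractAt i a i = a i - a i.other :=
  if_pos rfl

theorem subtractAt_of_ne {i l : Letter} (h : l ≠ i) (a : Letter → ℝ) :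
    subtractAt i a l = a l :=
  if_neg h

section Subtractive

variable {s : ℕ → Letter} {a : ℕ → Letter → ℝ}

theorem run_subtractAt (step : ∀ n, a (n + 1) = subtractAt (s n) (a n)) {c d : Letter}
    (hcd : d ≠ c) {N : ℕ} (m : ℕ) (hm : ∀ r < m, s (N + r) = c) :
    a (N + m) c = a N c - m * a N d ∧ a (N + m) d = a N d := by
  induction m with
  | zero => simp
  | succ m ih =>
    obtain ⟨h1, h2⟩ := ih fun r hr => hm r (by omega)
    rw [← add_assoc, step, hm m (by omega), subtractAt_self, subtractAt_of_ne hcd,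
      Letter.eq_of_ne_of_ne c.other_ne hcd, h1, h2]
    push_cast
    exact ⟨by ring, rfl⟩

theorem subtractive_pos (step : ∀ n, a (n + 1) = subtractAt (s n) (a n))
    (hnn : ∀ n l, 0 ≤ a n l) (hs : ∀ c N, ∃ n, s (N + n) ≠ c) (hne : ∃ l, a 0 l ≠ 0)
    (n : ℕ) (l : Letter) : 0 < a n l := by
  classical
  have key : ∀ n, (∃ l, a n l ≠ 0) → ∀ l, 0 < a n l := by
    rintro n ⟨l', hl'⟩ l
    by_contra hl
    have hl0 : a n l = 0 := le_antisymm (not_lt.mp hl) (hnn n l)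
    have hll : l' ≠ l := fun h => hl' (h ▸ hl0)
    have hmin := fun r hr => not_not.mp (Nat.find_min (hs l' n) (m := r) hr)
    obtain ⟨h1, h2⟩ := run_subtractAt step hll.symm _ hmin
    have h3 : s (n + Nat.find (hs l' n)) = l :=
      Letter.eq_of_ne_of_ne (Nat.find_spec (hs l' n)) hll.symm
    have h4 := hnn (n + Nat.find (hs l' n) + 1) l
    rw [step, h3, subtractAt_self, Letter.eq_of_ne_of_ne l.other_ne hll, h1, h2, hl0] at h4
    have h5 := lt_of_le_of_ne (hnn n l') hl'.symm
    linarith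
  have hne' : ∀ n, ∃ l, a n l ≠ 0 := by
    intro n
    induction n with
    | zero => exact hne
    | succ n ih =>
      refine ⟨(s n).other, ?_⟩
      rw [step, subtractAt_of_ne (Letter.other_ne _)]
      exact (key n ih _).ne'
  exact key n (hne' n) l

theorem hasContFractExpansion_of_subtractive
    (step : ∀ n, a (n + 1) = subtractAt (s n) (a n)) (hpos : ∀ n l, 0 < a n l) {b : ℕ → ℕ}
    (hb : IsRunLength s b) :
    HasContFractExpansion (a 0 Letter.one / a 0 Letter.two) b := by
  refine hasContFractExpansion_of_recurrence
    (y := fun k => a (∑ l ∈ Finset.range k, b l) (runLetter k) /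
      a (∑ l ∈ Finset.range k, b l) (runLetter (k + 1)))
    (fun k => div_pos (hpos _ _) (hpos _ _)) (fun k => hb.1 _ (by omega)) fun k => ?_
  obtain ⟨h1, h2⟩ := run_subtractAt step (runLetter_succ_ne k) (b k) (hb.2 k)
  have h3 : runLetter (k + 1 + 1) = runLetter k :=
    Letter.eq_of_ne_of_ne (runLetter_succ_ne (k + 1)) (runLetter_succ_ne k).symm
  have hd := hpos (∑ l ∈ Finset.range k, b l) (runLetter (k + 1))
  simp only [h3, Finset.sum_range_succ, h1, h2]
  field_simp
  ring

end Subtractive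

/-! ### Limit directions of the vectors of letter counts -/

/-- The pair `a` is a limit of rescaled letter counts of prefixes of `w`. -/
def IsDirection (w : ℕ → Letter) (a : Letter → ℝ) : Prop :=
  ∃ (φ : ℕ → ℕ) (c : ℕ → ℝ), (∀ k, 0 ≤ c k) ∧ Filter.Tendsto c Filter.atTop (nhds 0) ∧
    ∀ l, Filter.Tendsto (fun k => c k * (Nat.count (fun m => w m = l) (φ k) : ℝ))
      Filter.atTop (nhds (a l))

theorem IsDirection.nonneg {w : ℕ → Letter} {a : Letter → ℝ} (h : IsDirection w a)
    (l : Letter) : 0 ≤ a l := by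
  obtain ⟨φ, c, hc, -, ha⟩ := h
  exact ge_of_tendsto' (ha l) fun k => mul_nonneg (hc k) (Nat.cast_nonneg _)

open Classical in
theorem IsDirection.eraseBefore {w : ℕ → Letter} {a : Letter → ℝ} (ha : IsDirection w a)
    {i : Letter} (h : ∀ n, w n = i ∨ w (n + 1) = i) :
    IsDirection (eraseBefore i w) (subtractAt i a) := by
  obtain ⟨φ, c, hc, hc0, ha⟩ := ha
  refine ⟨fun k => Nat.count (Kept i w) (φ k), c, hc, hc0, fun l => ?_⟩
  by_cases hl : l = i
  · subst hl
    rw [subtractAt_self]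
    set e : ℕ → ℝ := fun k => (if w 0 = l.other then 1 else 0) -
      (if w (φ k) = l.other then 1 else 0) with he
    have hbound : ∀ k, |c k * e k| ≤ c k := by
      intro k
      rw [abs_mul, abs_of_nonneg (hc k)]
      refine mul_le_of_le_one_right (hc k) ?_
      simp only [he]
      split_ifs <;> norm_num
    have hlim := ((ha l).sub (ha l.other)).add
      (squeeze_zero_norm (f := fun k => c k * e k) hbound hc0)
    rw [add_zero] at hlim
    refine hlim.congr fun k => ?_
    have hcount := count_eraseBefore_self h l.other_ne (φ k)
    rw [Nat.count_succ] at hcount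
    have hcount' := congrArg (Nat.cast : ℕ → ℝ) hcount
    push_cast at hcount'
    rw [← mul_sub, ← mul_add]
    congr 1
    simp only [he]
    linarith
  · rw [subtractAt_of_ne hl]
    simp only [count_eraseBefore_of_ne hl]
    exact ha l

theorem IsDirection.hasContFractExpansion {w : ℕ → Letter} (ha : IsAperiodic w)
    (hu : UniqueRightSpecial w) {a : Letter → ℝ} (hd : IsDirection w a) (hne : ∃ l, a l ≠ 0)
    {b : ℕ → ℕ} (hb : IsRunLength (operatorSeq w) b) :
    (∀ l, 0 < a l) ∧ HasContFractExpansion (a Letter.one / a Letter.two) b := by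
  let v : ℕ → Letter → ℝ := fun n => Nat.rec a (fun n r => subtractAt (operatorSeq w n) r) n
  have step : ∀ n, v (n + 1) = subtractAt (operatorSeq w n) (v n) := fun _ => rfl
  have hdir : ∀ n, IsDirection (renorm^[n] w) (v n) := by
    intro n
    induction n with
    | zero => exact hd
    | succ n ih =>
      rw [Function.iterate_succ_apply', step]
      obtain ⟨ha', hu'⟩ := iterate_renorm ha hu n
      exact ih.eraseBefore (eq_wordType_or ha' hu')
  have hpos := subtractive_pos step (fun n l => (hdir n).nonneg l)
    (exists_operatorSeq_ne ha hu) hne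
  exact ⟨hpos 0, hasContFractExpansion_of_subtractive step hpos hb⟩

/-! ### Frequencies -/

theorem count_one_add_count_two (w : ℕ → Letter) (n : ℕ) :
    Nat.count (fun k => w k = Letter.one) n + Nat.count (fun k => w k = Letter.two) n = n := by
  induction n with
  | zero => simp
  | succ n ih =>
    rw [Nat.count_succ, Nat.count_succ]
    rcases h : w n with _ | _ <;> simp <;> omega

theorem count_two_div (w : ℕ → Letter) {n : ℕ} (hn : n ≠ 0) :
    (Nat.count (fun k => w k = Letter.two) n : ℝ) / n =
      1 - (Nat.count (fun k => w k = Letter.one) n : ℝ) / n := by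
  have h : (Nat.count (fun k => w k = Letter.one) n : ℝ) +
      Nat.count (fun k => w k = Letter.two) n = n := by
    exact_mod_cast count_one_add_count_two w n
  have hn' : (n : ℝ) ≠ 0 := by exact_mod_cast hn
  field_simp
  linarith

theorem HasFrequency.two {w : ℕ → Letter} {f : ℝ} (h : HasFrequency w Letter.one f) :
    HasFrequency w Letter.two (1 - f) := by
  refine (h.const_sub 1).congr' ?_
  filter_upwards [Filter.eventually_ne_atTop 0] with n hn using (count_two_div w hn).symm

theorem isDirection_of_tendsto {w : ℕ → Letter} {φ : ℕ → ℕ} {f : ℝ}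
    (hφ : Filter.Tendsto φ Filter.atTop Filter.atTop)
    (hf : Filter.Tendsto
      (fun k => (Nat.count (fun m => w m = Letter.one) (φ k) : ℝ) / (φ k : ℝ))
      Filter.atTop (nhds f)) :
    IsDirection w (fun l => if l = Letter.one then f else 1 - f) := by
  refine ⟨φ, fun k => (φ k : ℝ)⁻¹, fun k => by positivity,
    tendsto_inv_atTop_zero.comp (tendsto_natCast_atTop_atTop.comp hφ), fun l => ?_⟩
  simp only [inv_mul_eq_div]
  cases l with
  | one => simpa using hf
  | two =>
    simp only [reduceCtorEq, if_false]
    refine (hf.const_sub 1).congr' ?_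
    filter_upwards [hφ.eventually (Filter.eventually_ne_atTop 0)] with k hk using
      (count_two_div w hk).symm

theorem exists_frequency {w : ℕ → Letter} (ha : IsAperiodic w) (hu : UniqueRightSpecial w)
    {b : ℕ → ℕ} (hb : IsRunLength (operatorSeq w) b) :
    ∃ f : ℝ, HasFrequency w Letter.one f ∧ HasContFractExpansion (f / (1 - f)) b := by
  have hcluster : ∀ (φ : ℕ → ℕ) (f : ℝ), Filter.Tendsto φ Filter.atTop Filter.atTop →
      Filter.Tendsto (fun k => (Nat.count (fun m => w m = Letter.one) (φ k) : ℝ) / (φ k : ℝ))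
      Filter.atTop (nhds f) → 0 < 1 - f ∧ HasContFractExpansion (f / (1 - f)) b := by
    intro φ f hφ hf
    obtain ⟨h1, h2⟩ := (isDirection_of_tendsto hφ hf).hasContFractExpansion ha hu
      (by
        by_contra! h
        have h1 := h Letter.one
        have h2 := h Letter.two
        simp only [reduceCtorEq, if_true, if_false] at h1 h2
        linarith) hb
    exact ⟨by simpa using h1 Letter.two, by simpa using h2⟩
  have hmem : ∀ n : ℕ, (Nat.count (fun m => w m = Letter.one) n : ℝ) / (n : ℝ) ∈
      Set.Icc (0 : ℝ) 1 := fun n =>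
    ⟨by positivity, div_le_one_of_le₀ (Nat.cast_le.mpr (Nat.count_le _)) (by positivity)⟩
  have hsub : ∀ φ : ℕ → ℕ, ∃ f, ∃ ψ : ℕ → ℕ, StrictMono ψ ∧ Filter.Tendsto
      (fun k => (Nat.count (fun m => w m = Letter.one) (φ (ψ k)) : ℝ) / (φ (ψ k) : ℝ))
      Filter.atTop (nhds f) := fun φ => by
    obtain ⟨f, -, ψ, hψ, hf⟩ := isCompact_Icc.tendsto_subseq fun k => hmem (φ k)
    exact ⟨f, ψ, hψ, hf⟩
  obtain ⟨f, ψ, hψ, hf⟩ := hsub id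
  obtain ⟨hf1, hfb⟩ := hcluster ψ f hψ.tendsto_atTop hf
  refine ⟨f, Filter.tendsto_of_subseq_tendsto fun φ hφ => ?_, hfb⟩
  obtain ⟨g, χ, hχ, hg⟩ := hsub φ
  obtain ⟨hg1, hgb⟩ := hcluster (φ ∘ χ) g (hφ.comp hχ.tendsto_atTop) hg
  have heq := hfb.unique hgb
  rw [div_eq_div_iff hf1.ne' hg1.ne'] at heq
  obtain rfl : f = g := by linarith
  exact ⟨χ, hg⟩

end Sturmian

theorem mainTheorem8 (w : ℕ → Sturmian.Letter) (hw : Sturmian.IsSturmian w) :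
    (∃! b : ℕ → ℕ, Sturmian.IsRunLength (Sturmian.operatorSeq w) b) ∧
    ∃ f₁ f₂ : ℝ,
      Sturmian.HasFrequency w Sturmian.Letter.one f₁ ∧
      Sturmian.HasFrequency w Sturmian.Letter.two f₂ ∧
      (∀ b : ℕ → ℕ, Sturmian.IsRunLength (Sturmian.operatorSeq w) b →
        Sturmian.HasContFractExpansion (f₁ / f₂) b) ∧
      Irrational (f₁ / f₂) := by
  have ha := hw.isAperiodic
  have hu := hw.uniqueRightSpecial
  obtain ⟨b, hb⟩ := Sturmian.exists_isRunLength (Sturmian.exists_operatorSeq_ne ha hu)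
  obtain ⟨f, hf, hfb⟩ := Sturmian.exists_frequency ha hu hb
  refine ⟨⟨b, hb, fun b' hb' => hb'.unique hb⟩, f, 1 - f, hf, hf.two, fun b' hb' => ?_,
    hfb.irrational⟩
  rwa [hb'.unique hb]
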